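/- **Theorem 2.3 (Existence of minimal solutions).** Let $n\ge 1$, let $\Omega\subset\mathbb R^n$ be a bounded domain with smooth boundary, let $0\le\gamma<1$, $\alpha=\frac{4}{3+\gamma}$, $\delta>0$, and let $\mathcal B:\mathbb R\to\mathbb R$ be a Lipschitz function with $0\le\mathcal B(s)\le 1$ for $s\ge 0$, $\mathcal B(s)=0$ for $s\le\delta/2$ and $\mathcal B(s)=1$ for $s\ge\delta$. For $\varepsilon>0$ put $\mathcal B_\varepsilon(s)=\mathcal B(s/\varepsilon^\alpha)$, where $\mathcal B_\varepsilon(s)s^{-\gamma}$ is understood to be $0$ for $s\le 0$, and let $\Delta_\infty u=\sum_{i,j}D_{ij}u\,D_iu\,D_ju$. For each $\varepsilon>0$ let $\varphi_\varepsilon\in W^{2,\infty}(\partial\Omega)$ be a nonnegative boundary datum (identified with its continuous representative). Then, for each $\varepsilon>0$, the problem $$\Delta_\infty u=\mathcal B_\varepsilon(u)\,u^{-\gamma}\ \text{ in }\Omega,\qquad u=\varphi_\varepsilon\ \text{ on }\partial\Omega \tag{$P_\varepsilon$}$$ has a nonnegative minimal viscosity solution $u_\varepsilon\in C(\overline\Omega)$;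 minimal means that $u_\varepsilon\le w$ on $\overline\Omega$ for every viscosity supersolution $w\in C(\overline\Omega)$ of the equation with $w\ge\varphi_\varepsilon$ on $\partial\Omega$. Moreover, the family $\{u_\varepsilon\}$ is locally Lipschitz-equicontinuous as long as the boundary data stay bounded: if $S\subset(0,\infty)$ and $\sup_{\varepsilon\in S}\sup_{\partial\Omega}\varphi_\varepsilon<\infty$, then for every compact $K\subset\Omega$ there is a constant $L$ such that $|u_\varepsilon(x)-u_\varepsilon(y)|\le L|x-y|$ for all $x,y\in K$ and all $\varepsilon\in S$. -/

import Mathlib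

open Set Filter Topology MeasureTheory
open scoped ContDiff NNReal ENNReal

noncomputable section

namespace InfSingular

/-- `ℝⁿ` with its Euclidean norm. -/
abbrev E (n : ℕ) : Type := EuclideanSpace ℝ (Fin n)

/-- The `i`-th vector of the standard basis of `ℝⁿ`. -/
def e {n : ℕ} (i : Fin n) : E n := EuclideanSpace.single i 1

/-- A bounded domain with smooth boundary: near every boundary point, `Ω` is the sublevel set
`{ρ < 0}` of a smooth function `ρ` with nonvanishing differential at that point. -/
structure IsBoundedSmoothDomain {n : ℕ} (Ω : Set (E n)) : Prop where
  isOpen : IsOpen Ω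
  isConnected : IsConnected Ω
  isBounded : Bornology.IsBounded Ω
  smooth_boundary : ∀ x ∈ frontier Ω, ∃ (U : Set (E n)) (ρ : E n → ℝ),
    IsOpen U ∧ x ∈ U ∧ ContDiffOn ℝ ∞ ρ U ∧ fderiv ℝ ρ x ≠ 0 ∧ ∀ y ∈ U, (y ∈ Ω ↔ ρ y < 0)

/-! ### The Sobolev class `W^{2,∞}` -/

/-- `g` is the weak partial derivative of `f` in the direction of `e i` on the open set `V`
(used for `f` and `g` in `L^∞(V)`, so that all integrals converge). -/
def IsWeakPartial {m : ℕ} (V : Set (E m)) (i : Fin m) (f g : E m → ℝ) : Prop :=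
  ∀ ζ : E m → ℝ, ContDiff ℝ ∞ ζ → HasCompactSupport ζ → tsupport ζ ⊆ V →
    ∫ x in V, f x * fderiv ℝ ζ x (e i) = - ∫ x in V, g x * ζ x

/-- `f ∈ W^{2,∞}(V)`: `f` and its weak derivatives of order one and two are in `L^∞(V)`. -/
def MemW2Inf {m : ℕ} (V : Set (E m)) (f : E m → ℝ) : Prop :=
  MemLp f ∞ (volume.restrict V) ∧
  ∃ (g : Fin m → E m → ℝ) (h : Fin m → Fin m → E m → ℝ),
    (∀ i, MemLp (g i) ∞ (volume.restrict V) ∧ IsWeakPartial V i f (g i)) ∧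
    (∀ i j, MemLp (h i j) ∞ (volume.restrict V) ∧ IsWeakPartial V j (g i) (h i j))

/-- `ψ : V → ∂Ω` is a smooth local parametrization of the hypersurface `∂Ω`: an injective immersion
of an open set of `ℝ^{n-1}` into `∂Ω`. (As `∂Ω` has dimension `n - 1`, such a map is a
diffeomorphism onto an open part of `∂Ω`.) -/
structure IsBoundaryParametrization {n : ℕ} (Ω : Set (E n)) (V : Set (E (n - 1)))
    (ψ : E (n - 1) → E n) : Prop where
  isOpen : IsOpen V
  contDiffOn : ContDiffOn ℝ ∞ ψ V
  mapsTo : MapsTo ψ V (frontier Ω)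
  injOn : InjOn ψ V
  immersion : ∀ y ∈ V, Function.Injective (fderiv ℝ ψ y)

/-- `φ ∈ W^{2,∞}(∂Ω)` (its continuous representative): `φ` is continuous on `∂Ω`, and around every
boundary point it is of class `W^{2,∞}` in some smooth local parametrization of `∂Ω`. -/
def MemW2InfBoundary {n : ℕ} (Ω : Set (E n)) (φ : E n → ℝ) : Prop :=
  ContinuousOn φ (frontier Ω) ∧
  ∀ x ∈ frontier Ω, ∃ (V : Set (E (n - 1))) (ψ : E (n - 1) → E n),
    IsBoundaryParametrization Ω V ψ ∧ x ∈ ψ '' V ∧ MemW2Inf V (φ ∘ ψ)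

/-! ### The infinity Laplacian and viscosity solutions of `Δ_∞ u = G(u)` -/

/-- `Δ_∞ f (x) = ∑_{i,j} D_{ij} f (x) D_i f (x) D_j f (x)`. -/
def infLaplacian {n : ℕ} (f : E n → ℝ) (x : E n) : ℝ :=
  ∑ i, ∑ j, fderiv ℝ (fderiv ℝ f) x (e i) (e j) * fderiv ℝ f x (e i) * fderiv ℝ f x (e j)

/-- Continuous viscosity subsolution of `Δ_∞ u = G(u)` in the open set `Ω`. -/
def IsViscositySubsolution {n : ℕ} (Ω : Set (E n)) (G : ℝ → ℝ) (u : E n → ℝ) : Prop :=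
  ContinuousOn u Ω ∧ ∀ x ∈ Ω, ∀ η : E n → ℝ, ContDiffAt ℝ 2 η x →
    IsLocalMax (fun y => u y - η y) x → G (u x) ≤ infLaplacian η x

/-- Continuous viscosity supersolution of `Δ_∞ u = G(u)` in the open set `Ω`. -/
def IsViscositySupersolution {n : ℕ} (Ω : Set (E n)) (G : ℝ → ℝ) (u : E n → ℝ) : Prop :=
  ContinuousOn u Ω ∧ ∀ x ∈ Ω, ∀ η : E n → ℝ, ContDiffAt ℝ 2 η x →
    IsLocalMin (fun y => u y - η y) x → infLaplacian η x ≤ G (u x)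

/-- `u ∈ C(closure Ω)` is a viscosity solution of `Δ_∞ u = G(u)` in `Ω`, `u = φ` on `∂Ω`. -/
structure IsDirichletSolution {n : ℕ} (Ω : Set (E n)) (G : ℝ → ℝ) (φ u : E n → ℝ) : Prop where
  continuousOn : ContinuousOn u (closure Ω)
  subsolution : IsViscositySubsolution Ω G u
  supersolution : IsViscositySupersolution Ω G u
  boundary : ∀ x ∈ frontier Ω, u x = φ x

/-- A minimal (Perron) solution of the Dirichlet problem: a solution that lies below every
supersolution in `C(closure Ω)` whose boundary values are at least `φ`. -/
structure IsMinimalSolution {n : ℕ} (Ω : Set (E n)) (G : ℝ → ℝ) (φ u : E n → ℝ) : Prop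
    extends IsDirichletSolution Ω G φ u where
  minimal : ∀ w : E n → ℝ, ContinuousOn w (closure Ω) → IsViscositySupersolution Ω G w →
    (∀ x ∈ frontier Ω, φ x ≤ w x) → ∀ x ∈ closure Ω, u x ≤ w x

/-! ### The penalized source term -/

/-- The conditions on the profile `B` with threshold `δ`. -/
structure IsPenalizationProfile (δ : ℝ) (B : ℝ → ℝ) : Prop where
  lipschitz : ∃ L : ℝ≥0, LipschitzWith L B
  mem_Icc : ∀ s, 0 ≤ s → 0 ≤ B s ∧ B s ≤ 1
  eq_zero : ∀ s, s ≤ δ / 2 → B s = 0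
  eq_one : ∀ s, δ ≤ s → B s = 1

/-- The source term `s ↦ B_ε(s) s^{-γ}`, where `B_ε(s) = B(s / ε^α)` and `α = 4 / (3 + γ)`. For the
profiles in use it vanishes for `s ≤ δ ε^α / 2`, in particular for `s ≤ 0`. -/
def penalizedSource (γ : ℝ) (B : ℝ → ℝ) (ε : ℝ) (s : ℝ) : ℝ :=
  B (s / ε ^ (4 / (3 + γ))) * s ^ (-γ)

/-- The functions `u ε`, `ε ∈ S`, are locally Lipschitz in `Ω` uniformly in `ε`. -/
def LocallyEquiLipschitzOn {n : ℕ} (Ω : Set (E n)) (S : Set ℝ) (u : ℝ → E n → ℝ) : Prop :=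
  ∀ K : Set (E n), IsCompact K → K ⊆ Ω → ∃ L : ℝ≥0, ∀ ε ∈ S, LipschitzOnWith L (u ε) K

end InfSingular

end

/-!
Perron's method from above: `u` is the pointwise infimum of all supersolutions lying above the
boundary datum. An infimum of supersolutions is a supersolution, and at a point where `u` failed
the subsolution test a competitor could be lowered below `u` by a bump.

The source is nonnegative, so `Δ_∞ u ≥ 0` whatever `ε` is, and `u` lies below the cones that bound
it on spheres. Its slope is therefore controlled by its oscillation and the distance to the
boundary alone. This gives interior continuity and the uniform local Lipschitz bound at once.

Cones with vertex at a boundary point are `∞`-harmonic away from the vertex, hence upper barriers,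
and adding a multiple of the squared distance turns them into strict subsolutions, hence lower
barriers for all competitors simultaneously. No regularity of the boundary is involved.
-/

namespace InfSingular

open Metric
open scoped Gradient

/-! ### Second derivatives along lines -/

section Line

theorem iteratedDeriv_two_nonneg_of_isLocalMin {f : ℝ → ℝ} {a : ℝ} (hf : ContinuousAt f a)
    (hmin : IsLocalMin f a) : 0 ≤ iteratedDeriv 2 f a := by
  by_contra! hneg
  have hmax : IsLocalMax f a := by
    refine isLocalMax_of_deriv_deriv_neg ?_ hmin.deriv_eq_zero hf
    rwa [iteratedDeriv_succ, iteratedDeriv_one] at hneg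
  have hconst : f =ᶠ[𝓝 a] fun _ => f a := by
    filter_upwards [hmin, hmax] with t h1 h2 using le_antisymm h2 h1
  rw [hconst.iteratedDeriv_eq 2] at hneg
  simp [iteratedDeriv_const] at hneg

variable {F : Type*} [NormedAddCommGroup F] [NormedSpace ℝ F] {f : F → ℝ} {x : F}

theorem tendsto_line (x d : F) : Tendsto (fun t : ℝ => x + t • d) (𝓝 0) (𝓝 x) :=
  Continuous.tendsto' (by fun_prop) _ _ (by simp)

theorem contDiffAt_comp_line (hf : ContDiffAt ℝ 2 f x) (d : F) :
    ContDiffAt ℝ 2 (fun t : ℝ => f (x + t • d)) 0 := by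
  refine ContDiffAt.comp (g := f) 0 ?_ (by fun_prop)
  simpa using hf

theorem iteratedDeriv_two_comp_line (hf : ContDiffAt ℝ 2 f x) (d : F) :
    iteratedDeriv 2 (fun t : ℝ => f (x + t • d)) 0 = fderiv ℝ (fderiv ℝ f) x d d := by
  have hline (t : ℝ) : HasDerivAt (fun t : ℝ => x + t • d) d t := by
    simpa using ((hasDerivAt_id t).smul_const d).const_add x
  have hfst : deriv (fun t : ℝ => f (x + t • d)) =ᶠ[𝓝 0] fun t => fderiv ℝ f (x + t • d) d := by
    have hdiff : ∀ᶠ y in 𝓝 x, DifferentiableAt ℝ f y :=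
      (hf.eventually (by simp)).mono fun _ hy => hy.differentiableAt (by norm_num)
    filter_upwards [(tendsto_line x d).eventually hdiff] with t ht
    exact (ht.hasFDerivAt.comp_hasDerivAt t (hline t)).deriv
  have hsnd : HasDerivAt (fun t : ℝ => fderiv ℝ f (x + t • d)) (fderiv ℝ (fderiv ℝ f) x d) 0 :=
    ((hf.fderiv_right (m := 1) (by norm_num)).differentiableAt
      (by norm_num)).hasFDerivAt.comp_hasDerivAt_of_eq 0 (hline 0) (by simp)
  rw [iteratedDeriv_succ, iteratedDeriv_one, hfst.deriv_eq]
  exact ((ContinuousLinearMap.apply ℝ ℝ d).hasFDerivAt.comp_hasDerivAt 0 hsnd).deriv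

end Line

/-! ### The infinity Laplacian -/

section InfLaplacian

variable {n : ℕ} {f g η : E n → ℝ} {x z : E n}

theorem infLaplacian_eq_fderiv_fderiv {d : E n} (hd : HasGradientAt f d x) :
    infLaplacian f x = fderiv ℝ (fderiv ℝ f) x d d := by
  have hcoord (i : Fin n) : fderiv ℝ f x (e i) = d i := by
    rw [hd.fderiv_apply, e, EuclideanSpace.inner_single_right]
    simp
  have hsum : d = ∑ i, d i • e i := by
    ext j
    simp [e, Pi.single_apply]
  conv_rhs => rw [hsum]
  simp only [infLaplacian, hcoord, map_sum, sum_apply, map_smul, smul_apply, smul_eq_mul,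
    Finset.mul_sum]
  rw [Finset.sum_comm]
  exact Finset.sum_congr rfl fun i _ => Finset.sum_congr rfl fun j _ => by ring

theorem infLaplacian_eq_iteratedDeriv (hf : ContDiffAt ℝ 2 f x) {d : E n}
    (hd : HasGradientAt f d x) :
    infLaplacian f x = iteratedDeriv 2 (fun t : ℝ => f (x + t • d)) 0 := by
  rw [infLaplacian_eq_fderiv_fderiv hd, iteratedDeriv_two_comp_line hf]

theorem infLaplacian_sub_const (f : E n → ℝ) (c : ℝ) :
    infLaplacian (fun y => f y - c) = infLaplacian f := by
  have hfderiv : fderiv ℝ (fun y => f y - c) = fderiv ℝ f := funext fun _ => fderiv_sub_const c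
  funext y
  simp only [infLaplacian, hfderiv]

theorem continuousAt_infLaplacian (hf : ContDiffAt ℝ 2 f x) :
    ContinuousAt (infLaplacian f) x := by
  have h1 : ContDiffAt ℝ 1 (fderiv ℝ f) x := hf.fderiv_right (by norm_num)
  have h2 : ContinuousAt (fderiv ℝ (fderiv ℝ f)) x :=
    (h1.fderiv_right (m := 0) (by norm_num)).continuousAt
  have h1' := h1.continuousAt
  unfold infLaplacian
  fun_prop

/-- Degenerate ellipticity. -/
theorem infLaplacian_le_of_isLocalMin_sub (hg : ContDiffAt ℝ 2 g x) (hη : ContDiffAt ℝ 2 η x)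
    (hmin : IsLocalMin (fun y => g y - η y) x) : infLaplacian η x ≤ infLaplacian g x := by
  have hgrad : HasGradientAt g (∇ g x) x := (hg.differentiableAt (by norm_num)).hasGradientAt
  have hgrad' : HasGradientAt η (∇ g x) x := by
    have hη' := (hη.differentiableAt (by norm_num)).hasFDerivAt
    have hzero := hmin.hasFDerivAt_eq_zero (hgrad.hasFDerivAt.sub hη')
    rwa [hasGradientAt_iff_hasFDerivAt, sub_eq_zero.1 hzero]
  have hgl := contDiffAt_comp_line hg (∇ g x)
  have hηl := contDiffAt_comp_line hη (∇ g x)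
  have hlmin : IsLocalMin (fun t : ℝ => g (x + t • ∇ g x) - η (x + t • ∇ g x)) 0 := by
    filter_upwards [(tendsto_line x (∇ g x)).eventually hmin] with t ht
    simpa using ht
  have hsnd := iteratedDeriv_two_nonneg_of_isLocalMin (hgl.sub hηl).continuousAt hlmin
  rw [iteratedDeriv_fun_sub hgl hηl] at hsnd
  rw [infLaplacian_eq_iteratedDeriv hg hgrad, infLaplacian_eq_iteratedDeriv hη hgrad']
  linarith

theorem contDiff_quartic (c σ : ℝ) (x : E n) :
    ContDiff ℝ 2 fun y : E n => c + σ * ‖y - x‖ ^ 4 := by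
  have hsq : ContDiff ℝ 2 fun y : E n => ‖y - x‖ ^ 2 := (contDiff_id.sub contDiff_const).norm_sq ℝ
  have hpow (y : E n) : ‖y - x‖ ^ 4 = (‖y - x‖ ^ 2) ^ 2 := by ring
  simp only [hpow]
  fun_prop

theorem infLaplacian_add_quartic (hη : ContDiffAt ℝ 2 η x) (c σ : ℝ) :
    infLaplacian (fun y => η y + (c + σ * ‖y - x‖ ^ 4)) x = infLaplacian η x := by
  set d := ∇ η x
  have hq := (contDiff_quartic c σ x).contDiffAt (x := x)
  have hgrad : HasGradientAt η d x := (hη.differentiableAt (by norm_num)).hasGradientAt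
  have hqfderiv : HasFDerivAt (fun y : E n => c + σ * ‖y - x‖ ^ 4) (0 : E n →L[ℝ] ℝ) x := by
    have hsq : HasFDerivAt (fun y : E n => ‖y - x‖ ^ 2) (2 • innerSL ℝ (x - x)) x :=
      ((hasFDerivAt_id x).sub_const x).norm_sq
    refine (((hsq.pow 2).const_mul σ).const_add c).congr_fderiv (by simp) |>.congr_of_eventuallyEq
      (.of_forall fun y => by ring)
  have hgrad' : HasGradientAt (fun y => η y + (c + σ * ‖y - x‖ ^ 4)) d x := by
    rw [hasGradientAt_iff_hasFDerivAt]
    exact (hgrad.hasFDerivAt.fun_add hqfderiv).congr_fderiv (add_zero _)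
  have hline : (fun t : ℝ => c + σ * ‖x + t • d - x‖ ^ 4) = fun t => c + σ * ‖d‖ ^ 4 * t ^ 4 := by
    funext t
    rw [add_sub_cancel_left, norm_smul, mul_pow, Real.norm_eq_abs, Even.pow_abs (by decide)]
    ring
  have hqsnd : iteratedDeriv 2 (fun t : ℝ => c + σ * ‖x + t • d - x‖ ^ 4) 0 = 0 := by
    rw [hline, iteratedDeriv_const_add (by norm_num),
      iteratedDeriv_const_mul_field, iteratedDeriv_fun_pow_zero]
    simp
  rw [infLaplacian_eq_iteratedDeriv (hη.add hq) hgrad',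
    iteratedDeriv_fun_add (contDiffAt_comp_line hη d) (contDiffAt_comp_line hq d), hqsnd, add_zero,
    infLaplacian_eq_iteratedDeriv hη hgrad]

/-- The radial function `c + A |y - z| + b |y - z|²`, a cone with vertex `z` for `b = 0`. These
serve as barriers. -/
noncomputable def radialQuadratic (c A b : ℝ) (z y : E n) : ℝ :=
  c + A * ‖y - z‖ + b * ‖y - z‖ ^ 2

theorem continuous_radialQuadratic (c A b : ℝ) (z : E n) :
    Continuous (radialQuadratic c A b z) := by
  unfold radialQuadratic
  fun_prop

theorem contDiffAt_radialQuadratic (c A b : ℝ) (hx : x ≠ z) :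
    ContDiffAt ℝ 2 (radialQuadratic c A b z) x := by
  have hnorm : ContDiffAt ℝ 2 (fun y => ‖y - z‖) x :=
    (contDiffAt_id.sub contDiffAt_const).norm ℝ (sub_ne_zero.2 hx)
  unfold radialQuadratic
  fun_prop

theorem hasGradientAt_radialQuadratic (c A b : ℝ) (hx : x ≠ z) :
    HasGradientAt (radialQuadratic c A b z) ((A / ‖x - z‖ + 2 * b) • (x - z)) x := by
  have hpos : 0 < ‖x - z‖ := norm_pos_iff.2 (sub_ne_zero.2 hx)
  have hsq : HasFDerivAt (fun y => ‖y - z‖ ^ 2) (2 • innerSL ℝ (x - z)) x :=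
    ((hasFDerivAt_id x).sub_const z).norm_sq
  have hnorm := hsq.sqrt (pow_ne_zero 2 hpos.ne')
  simp only [Real.sqrt_sq (norm_nonneg _)] at hnorm
  rw [hasGradientAt_iff_hasFDerivAt]
  refine (((hnorm.const_mul A).const_add c).add (hsq.const_mul b)).congr_fderiv ?_
  ext v
  simp
  field_simp

theorem infLaplacian_radialQuadratic (c A b : ℝ) (hx : x ≠ z) :
    infLaplacian (radialQuadratic c A b z) x = 2 * b * (A + 2 * b * ‖x - z‖) ^ 2 := by
  have hpos : 0 < ‖x - z‖ := norm_pos_iff.2 (sub_ne_zero.2 hx)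
  set k := A / ‖x - z‖ + 2 * b with hk
  have hkρ : k * ‖x - z‖ = A + 2 * b * ‖x - z‖ := by
    rw [hk]
    field_simp
  have hline : (fun t : ℝ => radialQuadratic c A b z (x + t • k • (x - z))) =ᶠ[𝓝 0] fun t =>
      (c + A * ‖x - z‖ + b * ‖x - z‖ ^ 2) +
        ((A + 2 * b * ‖x - z‖) * (k * ‖x - z‖) * t + b * (k * ‖x - z‖) ^ 2 * t ^ 2) := by
    have hev : ∀ᶠ t : ℝ in 𝓝 0, 0 < 1 + t * k :=
      Tendsto.eventually_const_lt (v := 1) one_pos (Continuous.tendsto' (by fun_prop) _ _ (by simp))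
    filter_upwards [hev] with t ht
    have hvec : x + t • k • (x - z) - z = (1 + t * k) • (x - z) := by module
    simp only [radialQuadratic, hvec, norm_smul, Real.norm_eq_abs, abs_of_pos ht]
    ring
  rw [infLaplacian_eq_iteratedDeriv (contDiffAt_radialQuadratic c A b hx)
    (hasGradientAt_radialQuadratic c A b hx), hline.iteratedDeriv_eq 2,
    iteratedDeriv_const_add (by norm_num), iteratedDeriv_fun_add (by fun_prop) (by fun_prop),
    iteratedDeriv_const_mul_field, iteratedDeriv_const_mul_field, iteratedDeriv_fun_pow_zero, ← hkρ]
  simp [iteratedDeriv_fun_id_zero]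
  ring

end InfLaplacian

/-! ### Viscosity tests and comparison -/

section Touching

theorem exists_isLocalMax_pos {X : Type*} [TopologicalSpace X] {K U : Set X} {f : X → ℝ} {x : X}
    (hK : IsCompact K) (hU : IsOpen U) (hUK : U ⊆ K) (hf : UpperSemicontinuousOn f K)
    (hbd : ∀ y ∈ K \ U, f y ≤ 0) (hx : x ∈ K) (hpos : 0 < f x) :
    ∃ z ∈ U, IsLocalMax f z ∧ 0 < f z := by
  obtain ⟨z, hzK, hz⟩ := hf.exists_isMaxOn ⟨x, hx⟩ hK
  have hzpos : 0 < f z := hpos.trans_le (hz hx)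
  have hzU : z ∈ U := by_contra fun h => (hbd z ⟨hzK, h⟩).not_gt hzpos
  exact ⟨z, hzU, hz.isLocalMax (mem_of_superset (hU.mem_nhds hzU) hUK), hzpos⟩

theorem exists_forall_closedBall_of_eventually {X : Type*} [PseudoMetricSpace X] {x : X}
    {P : X → ℝ → Prop} (h : ∀ᶠ p : X × ℝ in 𝓝 (x, 0), P p.1 p.2) :
    ∃ r > 0, ∀ y ∈ closedBall x r, ∀ s, |s| ≤ r → P y s := by
  obtain ⟨r, hr, hP⟩ := nhds_basis_closedBall.eventually_iff.1 h
  refine ⟨r, hr, fun y hy s hs => hP (x := (y, s)) ?_⟩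
  rw [← closedBall_prod_same]
  exact ⟨hy, by simpa using hs⟩

end Touching

section Viscosity

variable {n : ℕ} {G : ℝ → ℝ} {u v w g : E n → ℝ} {x : E n} {K U : Set (E n)}

/-- The test at the point `x` for viscosity subsolutions of `Δ_∞ u = G(u)`. No continuity is
included, because Perron's infimum passes the test before it is known to be continuous. -/
def IsViscositySubsolutionAt (G : ℝ → ℝ) (u : E n → ℝ) (x : E n) : Prop :=
  ∀ η : E n → ℝ, ContDiffAt ℝ 2 η x → IsLocalMax (fun y => u y - η y) x →
    G (u x) ≤ infLaplacian η x

/-- The test at the point `x` for viscosity supersolutions of `Δ_∞ u = G(u)`; no continuity is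
included. -/
def IsViscositySupersolutionAt (G : ℝ → ℝ) (u : E n → ℝ) (x : E n) : Prop :=
  ∀ η : E n → ℝ, ContDiffAt ℝ 2 η x → IsLocalMin (fun y => u y - η y) x →
    infLaplacian η x ≤ G (u x)

theorem IsViscositySupersolutionAt.congr (hu : IsViscositySupersolutionAt G u x)
    (h : v =ᶠ[𝓝 x] u) : IsViscositySupersolutionAt G v x := by
  intro η hη hmin
  rw [h.eq_of_nhds]
  exact hu η hη (hmin.congr (h.mono fun y hy => by simp only [hy]))

theorem IsViscositySupersolutionAt.inf (hu : IsViscositySupersolutionAt G u x)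
    (hv : IsViscositySupersolutionAt G v x) : IsViscositySupersolutionAt G (u ⊓ v) x := by
  wlog h : u x ≤ v x generalizing u v
  · rw [inf_comm]
    exact this hv hu (le_of_not_ge h)
  intro η hη hmin
  have hval : (u ⊓ v) x = u x := inf_eq_left.2 h
  rw [hval]
  refine hu η hη ?_
  filter_upwards [hmin] with y hy
  rw [hval] at hy
  exact hy.trans (sub_le_sub_right inf_le_left _)

theorem isViscositySupersolutionAt_of_contDiffAt (hg : ContDiffAt ℝ 2 g x)
    (h : infLaplacian g x ≤ G (g x)) : IsViscositySupersolutionAt G g x :=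
  fun _ hη hmin => (infLaplacian_le_of_isLocalMin_sub hg hη hmin).trans h

theorem le_of_isViscositySupersolutionAt (hK : IsCompact K) (hU : IsOpen U) (hUK : U ⊆ K)
    (hw : ContinuousOn w K) (hsuper : ∀ y ∈ U, IsViscositySupersolutionAt G w y)
    (hv : ContinuousOn v K) (hv2 : ∀ y ∈ U, ContDiffAt ℝ 2 v y)
    (hstrict : ∀ y ∈ U, w y < v y → G (w y) < infLaplacian v y)
    (hbd : ∀ y ∈ K \ U, v y ≤ w y) (hx : x ∈ K) : v x ≤ w x := by
  by_contra! hlt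
  obtain ⟨z, hzU, hmax, hzpos⟩ := exists_isLocalMax_pos hK hU hUK
    (hv.sub hw).upperSemicontinuousOn (fun y hy => sub_nonpos.2 (hbd y hy)) hx (sub_pos.2 hlt)
  have hmin : IsLocalMin (fun y => w y - v y) z := by simpa using hmax.neg
  exact (hsuper z hzU v (hv2 z hzU) hmin).not_gt (hstrict z hzU (sub_pos.1 hzpos))

theorem le_of_isViscositySubsolutionAt (hK : IsCompact K) (hU : IsOpen U) (hUK : U ⊆ K)
    (hu : UpperSemicontinuousOn u K) (hsub : ∀ y ∈ U, IsViscositySubsolutionAt G u y)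
    (hv : ContinuousOn v K) (hv2 : ∀ y ∈ U, ContDiffAt ℝ 2 v y)
    (hstrict : ∀ y ∈ U, v y < u y → infLaplacian v y < G (u y))
    (hbd : ∀ y ∈ K \ U, u y ≤ v y) (hx : x ∈ K) : u x ≤ v x := by
  by_contra! hlt
  obtain ⟨z, hzU, hmax, hzpos⟩ := exists_isLocalMax_pos (f := fun y => u y - v y) hK hU hUK
    (by simpa only [sub_eq_add_neg] using hu.add hv.fun_neg.upperSemicontinuousOn)
    (fun y hy => sub_nonpos.2 (hbd y hy)) hx (sub_pos.2 hlt)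
  exact (hsub z hzU v (hv2 z hzU) hmax).not_gt (hstrict z hzU (sub_pos.1 hzpos))

theorem continuousAt_source_sub_infLaplacian (hG : Continuous G) (hg : ContDiffAt ℝ 2 g x) :
    ContinuousAt (fun p : E n × ℝ => G (g p.1 + p.2) - infLaplacian g p.1) (x, 0) := by
  have hg1 : ContinuousAt (fun p : E n × ℝ => g p.1) (x, 0) := hg.continuousAt.fst''
  exact (hG.continuousAt.comp (hg1.add continuousAt_snd)).sub (continuousAt_infLaplacian hg).fst''

theorem exists_strict_touching_of_not_isViscositySubsolutionAt (hG : Continuous G) (hU : U ∈ 𝓝 x)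
    (hnot : ¬ IsViscositySubsolutionAt G u x) :
    ∃ g : E n → ℝ, ∃ r > 0, g x = u x ∧ ∀ y ∈ closedBall x r, y ∈ U ∧ ContDiffAt ℝ 2 g y ∧
      u y + ‖y - x‖ ^ 4 ≤ g y ∧ ∀ s, |s| ≤ r → infLaplacian g y < G (g y + s) := by
  simp only [IsViscositySubsolutionAt, not_forall, not_le] at hnot
  obtain ⟨η, hη, hmax, hlt⟩ := hnot
  set g := fun y => η y + ((u x - η x) + 1 * ‖y - x‖ ^ 4) with hgdef
  have hgx : g x = u x := by simp [hgdef]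
  have hg : ContDiffAt ℝ 2 g x := hη.add (contDiff_quartic _ _ x).contDiffAt
  have htouch : ∀ᶠ y in 𝓝 x, u y + ‖y - x‖ ^ 4 ≤ g y :=
    hmax.mono fun y hy => by simp only [hgdef]; linarith
  have hstrict : ∀ᶠ p : E n × ℝ in 𝓝 (x, 0), infLaplacian g p.1 < G (g p.1 + p.2) := by
    have hpos : 0 < G (g x + 0) - infLaplacian g x := by
      rw [add_zero, hgx, infLaplacian_add_quartic hη]
      exact sub_pos.2 hlt
    exact ((continuousAt_source_sub_infLaplacian hG hg).eventually_const_lt hpos).mono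
      fun _ hp => sub_pos.1 hp
  obtain ⟨r, hr, h⟩ := exists_forall_closedBall_of_eventually
    (P := fun y s => (y ∈ U ∧ ContDiffAt ℝ 2 g y ∧ u y + ‖y - x‖ ^ 4 ≤ g y) ∧
      infLaplacian g y < G (g y + s))
    (((eventually_mem_set.2 hU).and ((hg.eventually (by simp)).and htouch)).prod_inl_nhds 0
      |>.and hstrict)
  refine ⟨g, r, hr, hgx, fun y hy => ?_⟩
  obtain ⟨hyU, hyg, hyt⟩ := (h y hy 0 (by simpa using hr.le)).1
  exact ⟨hyU, hyg, hyt, fun s hs => (h y hy s hs).2⟩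

theorem exists_strict_touching_of_not_isViscositySupersolutionAt (hG : Continuous G)
    (hU : U ∈ 𝓝 x) (hnot : ¬ IsViscositySupersolutionAt G u x) :
    ∃ g : E n → ℝ, ∃ r > 0, g x = u x ∧ ∀ y ∈ closedBall x r, y ∈ U ∧ ContDiffAt ℝ 2 g y ∧
      g y + ‖y - x‖ ^ 4 ≤ u y ∧ ∀ s, |s| ≤ r → G (g y + s) < infLaplacian g y := by
  simp only [IsViscositySupersolutionAt, not_forall, not_le] at hnot
  obtain ⟨η, hη, hmin, hlt⟩ := hnot
  set g := fun y => η y + ((u x - η x) + (-1) * ‖y - x‖ ^ 4) with hgdef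
  have hgx : g x = u x := by simp [hgdef]
  have hg : ContDiffAt ℝ 2 g x := hη.add (contDiff_quartic _ _ x).contDiffAt
  have htouch : ∀ᶠ y in 𝓝 x, g y + ‖y - x‖ ^ 4 ≤ u y :=
    hmin.mono fun y hy => by simp only [hgdef]; linarith
  have hstrict : ∀ᶠ p : E n × ℝ in 𝓝 (x, 0), G (g p.1 + p.2) < infLaplacian g p.1 := by
    have hneg : G (g x + 0) - infLaplacian g x < 0 := by
      rw [add_zero, hgx, infLaplacian_add_quartic hη]
      exact sub_neg.2 hlt
    exact ((continuousAt_source_sub_infLaplacian hG hg).eventually_lt_const hneg).mono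
      fun _ hp => sub_neg.1 hp
  obtain ⟨r, hr, h⟩ := exists_forall_closedBall_of_eventually
    (P := fun y s => (y ∈ U ∧ ContDiffAt ℝ 2 g y ∧ g y + ‖y - x‖ ^ 4 ≤ u y) ∧
      G (g y + s) < infLaplacian g y)
    (((eventually_mem_set.2 hU).and ((hg.eventually (by simp)).and htouch)).prod_inl_nhds 0
      |>.and hstrict)
  refine ⟨g, r, hr, hgx, fun y hy => ?_⟩
  obtain ⟨hyU, hyg, hyt⟩ := (h y hy 0 (by simpa using hr.le)).1
  exact ⟨hyU, hyg, hyt, fun s hs => (h y hy s hs).2⟩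

theorem isViscositySupersolutionAt_of_isGLB (hG : Continuous G) (hU : IsOpen U) (hx : x ∈ U)
    {𝓕 : Set (E n → ℝ)} (hcont : ∀ w ∈ 𝓕, ContinuousOn w U)
    (hsuper : ∀ w ∈ 𝓕, ∀ y ∈ U, IsViscositySupersolutionAt G w y)
    (hu : ∀ y ∈ U, IsGLB ((fun w => w y) '' 𝓕) (u y)) : IsViscositySupersolutionAt G u x := by
  by_contra hnot
  obtain ⟨g, r, hr, hgx, hg⟩ :=
    exists_strict_touching_of_not_isViscositySupersolutionAt hG (hU.mem_nhds hx) hnot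
  obtain ⟨_, ⟨w, hw, rfl⟩, hwx⟩ := (isGLB_lt_iff (hu x hx)).1
    (lt_add_of_pos_right (u x) (lt_min hr (pow_pos hr 4)))
  obtain ⟨z, hz, hzmin⟩ := (isCompact_closedBall x r).exists_isMinOn
    (nonempty_closedBall.2 hr.le) (f := fun y => w y - g y)
    (((hcont w hw).mono fun y hy => (hg y hy).1).sub
      fun y hy => (hg y hy).2.1.continuousAt.continuousWithinAt)
  obtain ⟨hzU, hzg, hztouch, hzstrict⟩ := hg z hz
  have hlow : ‖z - x‖ ^ 4 ≤ w z - g z := by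
    have huw : u z ≤ w z := (hu z hzU).1 ⟨w, hw, rfl⟩
    linarith
  have hupp : w z - g z < min r (r ^ 4) := by
    have hzx : w z - g z ≤ w x - g x := hzmin (mem_closedBall_self hr.le)
    have hwx' : w x < u x + min r (r ^ 4) := hwx
    linarith [hzx, hwx']
  have hzball : z ∈ ball x r := by
    rw [mem_ball_iff_norm]
    exact lt_of_pow_lt_pow_left₀ 4 hr.le (hlow.trans_lt (hupp.trans_le (min_le_right _ _)))
  have hstrict : G (w z) < infLaplacian g z := by
    have hs : |w z - g z| ≤ r := by
      rw [abs_of_nonneg ((pow_nonneg (norm_nonneg _) 4).trans hlow)]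
      exact (hupp.trans_le (min_le_left _ _)).le
    simpa using hzstrict _ hs
  exact (hsuper w hw z hzU g hzg (hzmin.isLocalMin (closedBall_mem_nhds_of_mem hzball))).not_gt
    hstrict

end Viscosity

/-! ### Local Lipschitz estimate -/

section Lipschitz

variable {n : ℕ} {u : E n → ℝ} {x y : E n} {Ω K : Set (E n)}

theorem le_cone_of_isViscositySubsolutionAt {A r : ℝ} (hA : 0 ≤ A)
    (hu : UpperSemicontinuousOn u (closedBall x r))
    (hsub : ∀ z ∈ ball x r, IsViscositySubsolutionAt 0 u z)
    (hbd : ∀ z ∈ sphere x r, u z ≤ u x + A * r) (hy : y ∈ closedBall x r) :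
    u y ≤ u x + A * ‖y - x‖ := by
  have hbarrier (b : ℝ) (hb : 0 < b) : u y ≤ radialQuadratic (u x) (A + 2 * b * r) (-b) x y := by
    refine le_of_isViscositySubsolutionAt (U := ball x r \ {x}) (isCompact_closedBall x r)
      (isOpen_ball.sdiff isClosed_singleton) (sdiff_subset.trans ball_subset_closedBall) hu
      (fun z hz => hsub z hz.1) (continuous_radialQuadratic ..).continuousOn
      (fun z hz => contDiffAt_radialQuadratic _ _ _ hz.2) (fun z hz _ => ?_) (fun z hz => ?_) hy
    · rw [infLaplacian_radialQuadratic _ _ _ hz.2, Pi.zero_apply]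
      have hzr : ‖z - x‖ < r := mem_ball_iff_norm.1 hz.1
      have hslope : 0 < A + 2 * b * r + 2 * -b * ‖z - x‖ := by nlinarith
      nlinarith [pow_pos hslope 2]
    · rcases eq_or_ne z x with rfl | hzx
      · simp [radialQuadratic]
      · have hzs : z ∈ sphere x r := by
          rw [← closedBall_sdiff_ball]
          exact ⟨hz.1, fun h => hz.2 ⟨h, hzx⟩⟩
        have hzr : ‖z - x‖ = r := mem_sphere_iff_norm.1 hzs
        rw [radialQuadratic, hzr]
        nlinarith [hbd z hzs, sq_nonneg r]
  have hlim : Tendsto (fun b : ℝ => radialQuadratic (u x) (A + 2 * b * r) (-b) x y) (𝓝[>] 0)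
      (𝓝 (u x + A * ‖y - x‖)) := by
    unfold radialQuadratic
    exact (Continuous.tendsto' (by fun_prop) _ _ (by simp)).mono_left nhdsWithin_le_nhds
  exact ge_of_tendsto hlim (eventually_mem_nhdsWithin.mono hbarrier)

theorem exists_lipschitzOnWith_of_isViscositySubsolutionAt (hΩ : IsOpen Ω) (hK : IsCompact K)
    (hKΩ : K ⊆ Ω) (M : ℝ≥0) :
    ∃ L : ℝ≥0, ∀ u : E n → ℝ, UpperSemicontinuousOn u Ω →
      (∀ y ∈ Ω, IsViscositySubsolutionAt 0 u y) → (∀ y ∈ Ω, ∀ z ∈ Ω, u y ≤ u z + M) →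
      LipschitzOnWith L u K := by
  obtain ⟨r, hr, hthick⟩ := hK.exists_cthickening_subset_open hΩ hKΩ
  lift r to ℝ≥0 using hr.le
  refine ⟨M / r, fun u hu hsub hosc => LipschitzOnWith.of_le_add_mul _ fun y hy x hx => ?_⟩
  have hball : closedBall x r ⊆ Ω := (closedBall_subset_cthickening hx _).trans hthick
  push_cast
  by_cases hyx : y ∈ closedBall x r
  · rw [dist_eq_norm]
    refine le_cone_of_isViscositySubsolutionAt (by positivity) (hu.mono hball)
      (fun z hz => hsub z (hball (ball_subset_closedBall hz))) (fun z hz => ?_) hyx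
    rw [div_mul_cancel₀ _ hr.ne']
    exact hosc z (hball (sphere_subset_closedBall hz)) x (hKΩ hx)
  · have hM : (M : ℝ) ≤ M / r * dist y x := by
      rw [div_mul_eq_mul_div, le_div_iff₀ hr]
      exact mul_le_mul_of_nonneg_left (not_le.1 hyx).le M.coe_nonneg
    linarith [hosc y (hKΩ hy) x (hKΩ hx)]

end Lipschitz

/-! ### Upper functions and barriers -/

section UpperFunction

theorem exists_abs_sub_le_cone {X : Type*} [PseudoMetricSpace X] {K : Set X} {f : X → ℝ} {x : X}
    {κ : ℝ} (hK : IsCompact K) (hf : ContinuousOn f K) (hx : x ∈ K) (hκ : 0 < κ) :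
    ∃ A, 0 ≤ A ∧ ∀ y ∈ K, |f y - f x| ≤ κ + A * dist y x := by
  obtain ⟨C, hC⟩ := hK.exists_bound_of_continuousOn (f := fun y => f y - f x)
    (hf.sub continuousOn_const)
  obtain ⟨r, hr, hnear⟩ := continuousOn_iff.1 hf x hx κ hκ
  have hC0 : 0 ≤ C := (norm_nonneg _).trans (hC x hx)
  refine ⟨C / r, by positivity, fun y hy => ?_⟩
  rcases lt_or_ge (dist y x) r with hd | hd
  · have hlt : |f y - f x| < κ := hnear y hy hd
    have hcone : 0 ≤ C / r * dist y x := by positivity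
    linarith
  · have hfar : C ≤ C / r * dist y x := by
      rw [div_mul_eq_mul_div, le_div_iff₀ hr]
      exact mul_le_mul_of_nonneg_left hd hC0
    have hle : |f y - f x| ≤ C := hC y hy
    linarith

theorem exists_forall_lt_of_infClosed {X : Type*} [TopologicalSpace X] {K : Set X}
    {𝓕 : Set (X → ℝ)} {g : X → ℝ} (hK : IsCompact K) (hne : 𝓕.Nonempty) (hinf : InfClosed 𝓕)
    (hcont : ∀ w ∈ 𝓕, ContinuousOn w K) (hg : ContinuousOn g K)
    (hlt : ∀ y ∈ K, ∃ w ∈ 𝓕, w y < g y) : ∃ w ∈ 𝓕, ∀ y ∈ K, w y < g y := by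
  refine hK.induction_on (p := fun s => ∃ w ∈ 𝓕, ∀ y ∈ s, w y < g y) ?_ ?_ ?_ ?_
  · exact hne.imp fun w hw => ⟨hw, by simp⟩
  · rintro s t hst ⟨w, hw, h⟩
    exact ⟨w, hw, fun y hy => h y (hst hy)⟩
  · rintro s t ⟨w, hw, h⟩ ⟨w', hw', h'⟩
    refine ⟨w ⊓ w', hinf hw hw', ?_⟩
    rintro y (hy | hy)
    · exact inf_lt_of_left_lt (h y hy)
    · exact inf_lt_of_right_lt (h' y hy)
  · intro y hy
    obtain ⟨w, hw, h⟩ := hlt y hy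
    exact ⟨{z | w z < g z}, (hcont w hw y hy).eventually_lt (hg y hy) h, w, hw, fun _ hz => hz⟩

variable {n : ℕ} {Ω C U : Set (E n)} {G : ℝ → ℝ} {φ v w : E n → ℝ} {x z : E n}

/-- An upper function of the Dirichlet problem `Δ_∞ u = G(u)` in `Ω`, `u = φ` on `∂Ω`: a competitor
in Perron's method from above. -/
structure IsUpperFunction (Ω : Set (E n)) (G : ℝ → ℝ) (φ w : E n → ℝ) : Prop where
  continuousOn : ContinuousOn w (closure Ω)
  isViscositySupersolutionAt : ∀ x ∈ Ω, IsViscositySupersolutionAt G w x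
  le_boundary : ∀ x ∈ frontier Ω, φ x ≤ w x

theorem infClosed_isUpperFunction : InfClosed {w | IsUpperFunction Ω G φ w} :=
  fun _ hv _ hw => ⟨hv.continuousOn.inf hw.continuousOn,
    fun x hx => (hv.isViscositySupersolutionAt x hx).inf (hw.isViscositySupersolutionAt x hx),
    fun x hx => le_inf (hv.le_boundary x hx) (hw.le_boundary x hx)⟩

theorem notMem_of_mem_frontier (hΩ : IsOpen Ω) (hx : x ∈ frontier Ω) : x ∉ Ω := by
  rw [hΩ.frontier_eq] at hx
  exact hx.2

theorem IsUpperFunction.piecewise_inf [∀ y, Decidable (y ∈ C)] (hw : IsUpperFunction Ω G φ w)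
    (hΩ : IsOpen Ω) (hC : IsClosed C) (hU : IsOpen U) (hCU : C ⊆ U) (hUΩ : U ⊆ Ω)
    (hv : ContinuousOn v U) (hvsuper : ∀ y ∈ U, IsViscositySupersolutionAt G v y)
    (hle : ∀ y ∈ U \ C, w y ≤ v y) : IsUpperFunction Ω G φ (C.piecewise (w ⊓ v) w) := by
  have hin (y : E n) (hy : y ∈ U) : C.piecewise (w ⊓ v) w =ᶠ[𝓝 y] w ⊓ v := by
    filter_upwards [hU.mem_nhds hy] with z hz
    by_cases hzC : z ∈ C
    · simp [hzC]
    · simp [hzC, hle z ⟨hz, hzC⟩]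
  have hout (y : E n) (hy : y ∉ U) : C.piecewise (w ⊓ v) w =ᶠ[𝓝 y] w := by
    filter_upwards [hC.isOpen_compl.mem_nhds fun h => hy (hCU h)] with z hz
      using piecewise_eq_of_notMem _ _ _ hz
  refine ⟨fun y hy => ?_, fun y hy => ?_, fun y hy => ?_⟩
  · by_cases hyU : y ∈ U
    · exact ((hw.continuousOn y hy).inf (hv.continuousAt (hU.mem_nhds hyU)).continuousWithinAt
        ).congr_of_eventuallyEq ((hin y hyU).filter_mono nhdsWithin_le_nhds)
        (hin y hyU).eq_of_nhds
    · exact (hw.continuousOn y hy).congr_of_eventuallyEq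
        ((hout y hyU).filter_mono nhdsWithin_le_nhds) (hout y hyU).eq_of_nhds
  · have hwy := hw.isViscositySupersolutionAt y hy
    by_cases hyU : y ∈ U
    · exact (hwy.inf (hvsuper y hyU)).congr (hin y hyU)
    · exact hwy.congr (hout y hyU)
  · rw [(hout y fun h => notMem_of_mem_frontier hΩ hy (hUΩ h)).eq_of_nhds]
    exact hw.le_boundary y hy

theorem isCompact_frontier_of_isBounded (hΩb : Bornology.IsBounded Ω) : IsCompact (frontier Ω) :=
  hΩb.isCompact_closure.of_isClosed_subset isClosed_frontier frontier_subset_closure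

theorem isUpperFunction_cone {c A : ℝ} (hG : ∀ s, 0 ≤ G s) (hz : z ∉ Ω)
    (hφ : ∀ y ∈ frontier Ω, φ y ≤ c + A * ‖y - z‖) :
    IsUpperFunction Ω G φ (radialQuadratic c A 0 z) where
  continuousOn := (continuous_radialQuadratic ..).continuousOn
  isViscositySupersolutionAt y hy := by
    have hyz : y ≠ z := ne_of_mem_of_not_mem hy hz
    refine isViscositySupersolutionAt_of_contDiffAt (contDiffAt_radialQuadratic _ _ _ hyz) ?_
    simpa [infLaplacian_radialQuadratic _ _ _ hyz] using hG _
  le_boundary y hy := by simpa [radialQuadratic] using hφ y hy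

theorem exists_isUpperFunction_cone {κ : ℝ} (hΩ : IsOpen Ω) (hΩb : Bornology.IsBounded Ω)
    (hG : ∀ s, 0 ≤ G s) (hφ : ContinuousOn φ (frontier Ω)) (hx : x ∈ frontier Ω) (hκ : 0 < κ) :
    ∃ A, IsUpperFunction Ω G φ (radialQuadratic (φ x + κ) A 0 x) := by
  obtain ⟨A, -, hcone⟩ := exists_abs_sub_le_cone (isCompact_frontier_of_isBounded hΩb) hφ hx hκ
  refine ⟨A, isUpperFunction_cone hG (notMem_of_mem_frontier hΩ hx) fun y hy => ?_⟩
  rw [← dist_eq_norm]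
  linarith [(abs_le.1 (hcone y hy)).2]

theorem IsUpperFunction.radialQuadratic_le {c A b : ℝ} (hw : IsUpperFunction Ω G φ w)
    (hΩ : IsOpen Ω) (hΩb : Bornology.IsBounded Ω) (hz : z ∉ Ω)
    (hstrict : ∀ y ∈ Ω, ∀ s < radialQuadratic c A b z y, G s < 2 * b * (A + 2 * b * ‖y - z‖) ^ 2)
    (hφ : ∀ y ∈ frontier Ω, radialQuadratic c A b z y ≤ φ y) (hx : x ∈ closure Ω) :
    radialQuadratic c A b z x ≤ w x := by
  have hne (y : E n) (hy : y ∈ Ω) : y ≠ z := ne_of_mem_of_not_mem hy hz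
  refine le_of_isViscositySupersolutionAt hΩb.isCompact_closure hΩ subset_closure hw.continuousOn
    hw.isViscositySupersolutionAt (continuous_radialQuadratic ..).continuousOn
    (fun y hy => contDiffAt_radialQuadratic _ _ _ (hne y hy)) (fun y hy hlt => ?_)
    (fun y hy => ?_) hx
  · rw [infLaplacian_radialQuadratic _ _ _ (hne y hy)]
    exact hstrict y hy _ hlt
  · rw [← hΩ.frontier_eq] at hy
    exact (hφ y hy).trans (hw.le_boundary y hy)

theorem exists_cone_le_isUpperFunction {κ : ℝ} (hΩ : IsOpen Ω) (hΩb : Bornology.IsBounded Ω)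
    (hG : ∀ a, BddAbove (G '' Iic a)) (hφ : ContinuousOn φ (frontier Ω)) (hx : x ∈ frontier Ω)
    (hκ : 0 < κ) :
    ∃ A, ∀ w, IsUpperFunction Ω G φ w → ∀ y ∈ closure Ω, φ x - κ - A * ‖y - x‖ ≤ w y := by
  obtain ⟨A, hA, hcone⟩ := exists_abs_sub_le_cone (isCompact_frontier_of_isBounded hΩb) hφ hx hκ
  obtain ⟨R, hR⟩ := hΩb.closure.subset_closedBall x
  obtain ⟨m, hm⟩ := hG (φ x)
  have hR' (y : E n) (hy : y ∈ closure Ω) : ‖y - x‖ ≤ R := mem_closedBall_iff_norm.1 (hR hy)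
  set A' := A + 2 * R + |m| + 1 with hA'
  have hquad (y : E n) (hy : y ∈ closure Ω) :
      radialQuadratic (φ x - κ) (-A') 1 x y ≤ φ x - κ - A * ‖y - x‖ := by
    rw [radialQuadratic, hA']
    nlinarith [hR' y hy, norm_nonneg (y - x), abs_nonneg m]
  refine ⟨A', fun w hw y hy => le_trans ?_ (hw.radialQuadratic_le hΩ hΩb
    (notMem_of_mem_frontier hΩ hx) (c := φ x - κ) (A := -A') (b := 1) ?_ ?_ hy)⟩
  · rw [radialQuadratic]
    linarith [sq_nonneg ‖y - x‖]
  · intro z hz s hs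
    have hzR := hR' z (subset_closure hz)
    have hsφ : s ≤ φ x := by
      linarith [hquad z (subset_closure hz), mul_nonneg hA (norm_nonneg (z - x))]
    have hGs : G s ≤ |m| := (hm ⟨s, hsφ, rfl⟩).trans (le_abs_self m)
    have hslope : |m| + 1 ≤ A' - 2 * ‖z - x‖ := by rw [hA']; linarith
    nlinarith [hslope, abs_nonneg m]
  · intro z hz
    have hzx := (abs_le.1 (hcone z hz)).1
    rw [dist_eq_norm] at hzx
    linarith [hquad z (frontier_subset_closure hz)]

theorem IsUpperFunction.le_of_source_nonpos {a : ℝ} (hw : IsUpperFunction Ω G φ w) (hΩ : IsOpen Ω)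
    (hΩb : Bornology.IsBounded Ω) (hz : z ∉ Ω) (hG : ∀ s ≤ a, G s ≤ 0)
    (hφ : ∀ y ∈ frontier Ω, a ≤ φ y) (hx : x ∈ closure Ω) : a ≤ w x := by
  obtain ⟨R, hR0, hR⟩ := hΩb.closure.subset_closedBall_lt 0 z
  refine le_of_forall_pos_le_add fun κ hκ => ?_
  have hb : 0 < κ / R ^ 2 := by positivity
  have hva (y : E n) (hy : y ∈ closure Ω) : radialQuadratic (a - κ) 0 (κ / R ^ 2) z y ≤ a := by
    have hyR : ‖y - z‖ ≤ R := mem_closedBall_iff_norm.1 (hR hy)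
    have hsq : κ / R ^ 2 * ‖y - z‖ ^ 2 ≤ κ / R ^ 2 * R ^ 2 := by gcongr
    rw [div_mul_cancel₀ _ (by positivity)] at hsq
    rw [radialQuadratic]
    linarith
  have hle := hw.radialQuadratic_le hΩ hΩb hz (c := a - κ) (A := 0) (b := κ / R ^ 2)
    (fun y hy s hs => ?_) (fun y hy => (hva y (frontier_subset_closure hy)).trans (hφ y hy)) hx
  · have hlow : a - κ ≤ radialQuadratic (a - κ) 0 (κ / R ^ 2) z x := by
      rw [radialQuadratic]
      nlinarith [sq_nonneg ‖x - z‖]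
    linarith
  · have hyz : 0 < ‖y - z‖ := norm_pos_iff.2 (sub_ne_zero.2 (ne_of_mem_of_not_mem hy hz))
    exact (hG s (hs.le.trans (hva y (subset_closure hy)))).trans_lt (by positivity)

end UpperFunction

/-! ### Perron's method -/

section Perron

variable {n : ℕ} {Ω : Set (E n)} {G : ℝ → ℝ} {φ : E n → ℝ} {x : E n}

/-- The pointwise infimum of the upper functions, Perron's candidate for the minimal solution. It is
meaningful on `closure Ω`, where the upper functions are bounded below. -/
noncomputable def perronSolution (Ω : Set (E n)) (G : ℝ → ℝ) (φ : E n → ℝ) (x : E n) : ℝ :=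
  sInf ((fun w => w x) '' {w | IsUpperFunction Ω G φ w})

theorem ne_univ_of_isBounded (hn : 1 ≤ n) (hΩ : Bornology.IsBounded Ω) : Ω ≠ univ := by
  have : Nonempty (Fin n) := ⟨⟨0, hn⟩⟩
  rintro rfl
  exact NormedSpace.unbounded_univ ℝ (E n) hΩ

/-- The conditions under which Perron's method solves the Dirichlet problem `Δ_∞ u = G(u)` in `Ω`,
`u = φ` on `∂Ω`. -/
structure IsPerronProblem (Ω : Set (E n)) (G : ℝ → ℝ) (φ : E n → ℝ) : Prop where
  isOpen : IsOpen Ω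
  isBounded : Bornology.IsBounded Ω
  ne_univ : Ω ≠ univ
  continuous_source : Continuous G
  source_nonneg : ∀ s, 0 ≤ G s
  bddAbove_source : ∀ a, BddAbove (G '' Iic a)
  continuousOn_boundary : ContinuousOn φ (frontier Ω)

namespace IsPerronProblem

variable (h : IsPerronProblem Ω G φ)

include h

theorem isUpperFunction_const {M : ℝ} (hM : ∀ y ∈ frontier Ω, φ y ≤ M) :
    IsUpperFunction Ω G φ fun _ => M := by
  obtain ⟨z, hz⟩ := (ne_univ_iff_exists_notMem Ω).1 h.ne_univ
  convert isUpperFunction_cone (c := M) (A := 0) h.source_nonneg hz (by simpa using hM) using 2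
  simp [radialQuadratic]

theorem nonempty_isUpperFunction : {w | IsUpperFunction Ω G φ w}.Nonempty := by
  obtain ⟨M, hM⟩ :=
    (isCompact_frontier_of_isBounded h.isBounded).bddAbove_image h.continuousOn_boundary
  exact ⟨_, h.isUpperFunction_const fun y hy => hM ⟨y, hy, rfl⟩⟩

theorem nonempty_frontier (hx : x ∈ closure Ω) : (frontier Ω).Nonempty :=
  nonempty_frontier_iff.2 ⟨closure_nonempty_iff.1 ⟨x, hx⟩, h.ne_univ⟩

theorem isGLB_perronSolution (hx : x ∈ closure Ω) :
    IsGLB ((fun w => w x) '' {w | IsUpperFunction Ω G φ w}) (perronSolution Ω G φ x) := by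
  obtain ⟨p, hp⟩ := h.nonempty_frontier hx
  obtain ⟨A, hA⟩ := exists_cone_le_isUpperFunction h.isOpen h.isBounded h.bddAbove_source
    h.continuousOn_boundary hp one_pos
  exact isGLB_csInf (h.nonempty_isUpperFunction.image _)
    ⟨_, forall_mem_image.2 fun w hw => hA w hw x hx⟩

theorem perronSolution_le {w : E n → ℝ} (hw : IsUpperFunction Ω G φ w) (hx : x ∈ closure Ω) :
    perronSolution Ω G φ x ≤ w x :=
  (h.isGLB_perronSolution hx).1 ⟨w, hw, rfl⟩

theorem le_perronSolution {a : ℝ} (ha : ∀ w, IsUpperFunction Ω G φ w → a ≤ w x)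
    (hx : x ∈ closure Ω) : a ≤ perronSolution Ω G φ x :=
  (h.isGLB_perronSolution hx).2 (forall_mem_image.2 ha)

theorem exists_isUpperFunction_lt {a : ℝ} (hx : x ∈ closure Ω) (ha : perronSolution Ω G φ x < a) :
    ∃ w, IsUpperFunction Ω G φ w ∧ w x < a := by
  obtain ⟨_, ⟨w, hw, rfl⟩, hwa⟩ := (isGLB_lt_iff (h.isGLB_perronSolution hx)).1 ha
  exact ⟨w, hw, hwa⟩

theorem upperSemicontinuousOn_perronSolution :
    UpperSemicontinuousOn (perronSolution Ω G φ) (closure Ω) := by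
  intro x hx a ha
  obtain ⟨w, hw, hwa⟩ := h.exists_isUpperFunction_lt hx ha
  filter_upwards [(hw.continuousOn x hx).eventually_lt_const hwa, self_mem_nhdsWithin]
    with y hy hyΩ using (h.perronSolution_le hw hyΩ).trans_lt hy

theorem isViscositySupersolutionAt_perronSolution (hx : x ∈ Ω) :
    IsViscositySupersolutionAt G (perronSolution Ω G φ) x :=
  isViscositySupersolutionAt_of_isGLB h.continuous_source h.isOpen hx
    (fun _ hw => hw.continuousOn.mono subset_closure) (fun _ hw => hw.isViscositySupersolutionAt)
    fun _ hy => h.isGLB_perronSolution (subset_closure hy)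

theorem isViscositySubsolutionAt_perronSolution (hx : x ∈ Ω) :
    IsViscositySubsolutionAt G (perronSolution Ω G φ) x := by
  classical
  by_contra hnot
  obtain ⟨g, r, hr, hgx, hg⟩ := exists_strict_touching_of_not_isViscositySubsolutionAt
    h.continuous_source (h.isOpen.mem_nhds hx) hnot
  obtain ⟨κ, hκ, hκmin⟩ := exists_between (lt_min hr (pow_pos (half_pos hr) 4))
  obtain ⟨hκr, hκ4⟩ := lt_min_iff.1 hκmin
  have hball : closedBall x r ⊆ Ω := fun y hy => (hg y hy).1
  have hC2 (y : E n) (hy : y ∈ closedBall x r) : ContDiffAt ℝ 2 (fun z => g z - κ) y :=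
    (hg y hy).2.1.sub contDiffAt_const
  have hC0 : ContinuousOn (fun z => g z - κ) (closedBall x r) :=
    fun y hy => (hC2 y hy).continuousAt.continuousWithinAt
  obtain ⟨w, hw, hwlt⟩ : ∃ w ∈ {w | IsUpperFunction Ω G φ w},
      ∀ y ∈ closedBall x r \ ball x (r / 2), w y < g y - κ := by
    refine exists_forall_lt_of_infClosed ((isCompact_closedBall x r).diff isOpen_ball)
      h.nonempty_isUpperFunction infClosed_isUpperFunction
      (fun w hw => hw.continuousOn.mono (sdiff_subset.trans (hball.trans subset_closure)))
      (hC0.mono sdiff_subset) fun y hy => h.exists_isUpperFunction_lt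
        (subset_closure (hball hy.1)) ?_
    have hyr : r / 2 ≤ ‖y - x‖ := by simpa [dist_eq_norm] using hy.2
    have hquartic : (r / 2) ^ 4 ≤ ‖y - x‖ ^ 4 := by gcongr
    linarith [(hg y hy.1).2.2.1]
  have hsuper (y : E n) (hy : y ∈ ball x r) :
      IsViscositySupersolutionAt G (fun z => g z - κ) y := by
    have hy' := ball_subset_closedBall hy
    refine isViscositySupersolutionAt_of_contDiffAt (hC2 y hy') ?_
    rw [infLaplacian_sub_const, sub_eq_add_neg]
    exact ((hg y hy').2.2.2 (-κ) (by rw [abs_neg, abs_of_pos hκ]; exact hκr.le)).le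
  have hbump : IsUpperFunction Ω G φ ((closedBall x (r / 2)).piecewise (w ⊓ fun z => g z - κ) w) :=
    hw.piecewise_inf h.isOpen isClosed_closedBall isOpen_ball
      (closedBall_subset_ball (half_lt_self hr)) (ball_subset_closedBall.trans hball)
      (hC0.mono ball_subset_closedBall) hsuper fun y hy =>
        (hwlt y ⟨ball_subset_closedBall hy.1, fun h => hy.2 (ball_subset_closedBall h)⟩).le
  have hle := h.perronSolution_le hbump (subset_closure hx)
  rw [piecewise_eq_of_mem _ _ _ (mem_closedBall_self (half_pos hr).le)] at hle
  linarith [hle.trans (inf_le_right (a := w x) (b := g x - κ))]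

theorem isViscositySubsolutionAt_zero_perronSolution (hx : x ∈ Ω) :
    IsViscositySubsolutionAt 0 (perronSolution Ω G φ) x := fun η hη hmax =>
  (h.source_nonneg _).trans (h.isViscositySubsolutionAt_perronSolution hx η hη hmax)

theorem exists_abs_perronSolution_sub_le {κ : ℝ} (hx : x ∈ frontier Ω) (hκ : 0 < κ) :
    ∃ A, ∀ y ∈ closure Ω, |perronSolution Ω G φ y - φ x| ≤ κ + A * ‖y - x‖ := by
  obtain ⟨A, hA⟩ := exists_isUpperFunction_cone h.isOpen h.isBounded h.source_nonneg
    h.continuousOn_boundary hx hκ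
  obtain ⟨B, hB⟩ := exists_cone_le_isUpperFunction h.isOpen h.isBounded h.bddAbove_source
    h.continuousOn_boundary hx hκ
  refine ⟨max A B, fun y hy => abs_le.2 ⟨?_, ?_⟩⟩
  · have hmax : B * ‖y - x‖ ≤ max A B * ‖y - x‖ := by gcongr; exact le_max_right A B
    linarith [h.le_perronSolution (fun w hw => hB w hw y hy) hy]
  · have hmax : A * ‖y - x‖ ≤ max A B * ‖y - x‖ := by gcongr; exact le_max_left A B
    have hle := h.perronSolution_le hA hy
    rw [radialQuadratic] at hle
    linarith

theorem perronSolution_eq_of_mem_frontier (hx : x ∈ frontier Ω) : perronSolution Ω G φ x = φ x := by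
  refine eq_of_abs_sub_le_all fun κ hκ => ?_
  obtain ⟨A, hA⟩ := h.exists_abs_perronSolution_sub_le hx hκ
  simpa using hA x (frontier_subset_closure hx)

theorem exists_perronSolution_le_add :
    ∃ M : ℝ≥0, ∀ y ∈ Ω, ∀ z ∈ Ω, perronSolution Ω G φ y ≤ perronSolution Ω G φ z + M := by
  rcases (closure Ω).eq_empty_or_nonempty with hempty | ⟨x, hx⟩
  · exact ⟨0, fun y hy => by simp [closure_empty_iff Ω |>.1 hempty] at hy⟩
  obtain ⟨p, hp⟩ := h.nonempty_frontier hx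
  obtain ⟨A, hA⟩ := h.exists_abs_perronSolution_sub_le hp one_pos
  obtain ⟨C, hC⟩ := h.isBounded.isCompact_closure.bddAbove_image
    (f := fun y => 1 + A * ‖y - p‖) (by fun_prop)
  have hCy (y : E n) (hy : y ∈ Ω) : |perronSolution Ω G φ y - φ p| ≤ C :=
    (hA y (subset_closure hy)).trans (hC ⟨y, subset_closure hy, rfl⟩)
  refine ⟨(C + C).toNNReal, fun y hy z hz => ?_⟩
  linarith [(abs_le.1 (hCy y hy)).2, (abs_le.1 (hCy z hz)).1, Real.le_coe_toNNReal (C + C)]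

theorem continuousAt_perronSolution (hx : x ∈ Ω) : ContinuousAt (perronSolution Ω G φ) x := by
  obtain ⟨K, hK, hxK, hKΩ⟩ := exists_compact_subset h.isOpen hx
  obtain ⟨M, hM⟩ := h.exists_perronSolution_le_add
  obtain ⟨L, hL⟩ := exists_lipschitzOnWith_of_isViscositySubsolutionAt h.isOpen hK hKΩ M
  exact (hL _ (h.upperSemicontinuousOn_perronSolution.mono subset_closure)
    (fun _ hy => h.isViscositySubsolutionAt_zero_perronSolution hy) hM).continuousOn.continuousAt
    (mem_interior_iff_mem_nhds.1 hxK)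

theorem continuousWithinAt_perronSolution (hx : x ∈ frontier Ω) :
    ContinuousWithinAt (perronSolution Ω G φ) (closure Ω) x := by
  rw [ContinuousWithinAt, h.perronSolution_eq_of_mem_frontier hx, Metric.tendsto_nhds]
  intro ε hε
  obtain ⟨A, hA⟩ := h.exists_abs_perronSolution_sub_le hx (half_pos hε)
  have hsmall : ∀ᶠ y in 𝓝[closure Ω] x, ε / 2 + A * ‖y - x‖ < ε := by
    have hlim : Tendsto (fun y => ε / 2 + A * ‖y - x‖) (𝓝 x) (𝓝 (ε / 2)) :=
      Continuous.tendsto' (by fun_prop) _ _ (by simp)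
    exact (hlim.mono_left nhdsWithin_le_nhds).eventually_lt_const (half_lt_self hε)
  filter_upwards [hsmall, self_mem_nhdsWithin] with y hy hyΩ using (hA y hyΩ).trans_lt hy

theorem continuousOn_perronSolution : ContinuousOn (perronSolution Ω G φ) (closure Ω) := by
  intro x hx
  by_cases hxΩ : x ∈ Ω
  · exact (h.continuousAt_perronSolution hxΩ).continuousWithinAt
  · refine h.continuousWithinAt_perronSolution ?_
    rw [h.isOpen.frontier_eq]
    exact ⟨hx, hxΩ⟩

theorem isMinimalSolution_perronSolution : IsMinimalSolution Ω G φ (perronSolution Ω G φ) where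
  continuousOn := h.continuousOn_perronSolution
  subsolution := ⟨h.continuousOn_perronSolution.mono subset_closure,
    fun _ hx => h.isViscositySubsolutionAt_perronSolution hx⟩
  supersolution := ⟨h.continuousOn_perronSolution.mono subset_closure,
    fun _ hx => h.isViscositySupersolutionAt_perronSolution hx⟩
  boundary _ hx := h.perronSolution_eq_of_mem_frontier hx
  minimal _ hw hsuper hφ _ hx := h.perronSolution_le ⟨hw, hsuper.2, hφ⟩ hx

theorem le_perronSolution_of_source_nonpos {a : ℝ} (hG : ∀ s ≤ a, G s ≤ 0)
    (hφ : ∀ y ∈ frontier Ω, a ≤ φ y) (hx : x ∈ closure Ω) : a ≤ perronSolution Ω G φ x := by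
  obtain ⟨z, hz⟩ := (ne_univ_iff_exists_notMem Ω).1 h.ne_univ
  exact h.le_perronSolution (fun w hw => hw.le_of_source_nonpos h.isOpen h.isBounded hz hG hφ hx) hx

end IsPerronProblem

end Perron

/-! ### The penalized source -/

section Source

theorem bddAbove_image_Iic {G : ℝ → ℝ} (hG : Continuous G) (hzero : ∀ s ≤ 0, G s = 0) (a : ℝ) :
    BddAbove (G '' Iic a) := by
  refine ((isCompact_Icc (a := 0) (b := a)).bddAbove_image hG.continuousOn |>.union
    (bddAbove_singleton (a := 0))).mono (image_subset_iff.2 fun s hs => ?_)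
  rcases le_total s 0 with h | h
  · exact Or.inr (hzero s h)
  · exact Or.inl ⟨s, ⟨h, hs⟩, rfl⟩

variable {γ δ ε : ℝ} {B : ℝ → ℝ}

theorem penalizedSource_eq_zero (hε : 0 < ε) (hB : IsPenalizationProfile δ B) {s : ℝ}
    (hs : s ≤ δ / 2 * ε ^ (4 / (3 + γ))) : penalizedSource γ B ε s = 0 := by
  rw [penalizedSource, hB.eq_zero _ ((div_le_iff₀ (Real.rpow_pos_of_pos hε _)).2 hs), zero_mul]

theorem penalizedSource_eq_zero_of_nonpos (hδ : 0 ≤ δ) (hε : 0 < ε)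
    (hB : IsPenalizationProfile δ B) {s : ℝ} (hs : s ≤ 0) : penalizedSource γ B ε s = 0 :=
  penalizedSource_eq_zero hε hB (hs.trans (by positivity))

theorem continuous_penalizedSource (hδ : 0 < δ) (hε : 0 < ε) (hB : IsPenalizationProfile δ B) :
    Continuous (penalizedSource γ B ε) := by
  obtain ⟨L, hL⟩ := hB.lipschitz
  have hthreshold : 0 < δ / 2 * ε ^ (4 / (3 + γ)) := by positivity
  refine continuous_iff_continuousAt.2 fun s => ?_
  rcases lt_or_ge s (δ / 2 * ε ^ (4 / (3 + γ))) with h | h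
  · refine continuousAt_const.congr (f := fun _ => (0 : ℝ)) ?_
    filter_upwards [gt_mem_nhds h] with t ht using (penalizedSource_eq_zero hε hB ht.le).symm
  · exact (hL.continuous.comp (continuous_id.div_const _)).continuousAt.mul
      (Real.continuousAt_rpow_const s (-γ) (Or.inl (hthreshold.trans_le h).ne'))

theorem penalizedSource_nonneg (hδ : 0 ≤ δ) (hε : 0 < ε) (hB : IsPenalizationProfile δ B) (s : ℝ) :
    0 ≤ penalizedSource γ B ε s := by
  rcases le_total s 0 with h | h
  · exact (penalizedSource_eq_zero_of_nonpos hδ hε hB h).ge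
  · exact mul_nonneg (hB.mem_Icc _ (by positivity)).1 (Real.rpow_nonneg h _)

end Source

end InfSingular

open InfSingular in
theorem theorem2p3_general {n : ℕ} (hn : 1 ≤ n) {Ω : Set (E n)} (hΩ : IsOpen Ω)
    (hΩb : Bornology.IsBounded Ω) {P : Set ℝ} {G : ℝ → ℝ → ℝ} {φ : ℝ → E n → ℝ}
    (hG : ∀ ε ∈ P, Continuous (G ε)) (hG0 : ∀ ε ∈ P, ∀ s, 0 ≤ G ε s)
    (hGzero : ∀ ε ∈ P, ∀ s ≤ 0, G ε s = 0) (hφ : ∀ ε ∈ P, ContinuousOn (φ ε) (frontier Ω))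
    (hφ0 : ∀ ε ∈ P, ∀ x ∈ frontier Ω, 0 ≤ φ ε x) :
    ∃ u : ℝ → E n → ℝ,
      (∀ ε ∈ P, IsMinimalSolution Ω (G ε) (φ ε) (u ε) ∧ ∀ x ∈ closure Ω, 0 ≤ u ε x) ∧
      ∀ S ⊆ P, (∃ M : ℝ, ∀ ε ∈ S, ∀ x ∈ frontier Ω, φ ε x ≤ M) → LocallyEquiLipschitzOn Ω S u := by
  have h (ε : ℝ) (hε : ε ∈ P) : IsPerronProblem Ω (G ε) (φ ε) :=
    ⟨hΩ, hΩb, ne_univ_of_isBounded hn hΩb, hG ε hε, hG0 ε hε,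
      bddAbove_image_Iic (hG ε hε) (hGzero ε hε), hφ ε hε⟩
  have hnonneg (ε : ℝ) (hε : ε ∈ P) (x : E n) (hx : x ∈ closure Ω) :
      0 ≤ perronSolution Ω (G ε) (φ ε) x :=
    (h ε hε).le_perronSolution_of_source_nonpos (fun s hs => (hGzero ε hε s hs).le) (hφ0 ε hε) hx
  refine ⟨fun ε => perronSolution Ω (G ε) (φ ε), fun ε hε =>
    ⟨(h ε hε).isMinimalSolution_perronSolution, hnonneg ε hε⟩, ?_⟩
  rintro S hS ⟨M, hM⟩ K hK hKΩ
  obtain ⟨L, hL⟩ :=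
    exists_lipschitzOnWith_of_isViscositySubsolutionAt hΩ hK hKΩ M.toNNReal
  refine ⟨L, fun ε hε => ?_⟩
  have hε' := h ε (hS hε)
  refine hL _ (hε'.upperSemicontinuousOn_perronSolution.mono subset_closure)
    (fun x hx => hε'.isViscositySubsolutionAt_zero_perronSolution hx) fun y hy z hz => ?_
  have hyM := hε'.perronSolution_le (hε'.isUpperFunction_const (hM ε hε)) (subset_closure hy)
  linarith [hnonneg ε (hS hε) z (subset_closure hz), Real.le_coe_toNNReal M]

open InfSingular in
theorem theorem2p3 (n : ℕ) (hn : 1 ≤ n) (Ω : Set (E n)) (hΩ : IsBoundedSmoothDomain Ω)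
    (γ : ℝ) (hγ0 : 0 ≤ γ) (hγ1 : γ < 1)
    (δ : ℝ) (hδ : 0 < δ) (B : ℝ → ℝ) (hB : IsPenalizationProfile δ B)
    (φ : ℝ → E n → ℝ) (hφW : ∀ ε, 0 < ε → MemW2InfBoundary Ω (φ ε))
    (hφ0 : ∀ ε, 0 < ε → ∀ x ∈ frontier Ω, 0 ≤ φ ε x) :
    ∃ u : ℝ → E n → ℝ,
      (∀ ε, 0 < ε →
        IsMinimalSolution Ω (penalizedSource γ B ε) (φ ε) (u ε) ∧
        ∀ x ∈ closure Ω, 0 ≤ u ε x) ∧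
      ∀ S : Set ℝ, S ⊆ Set.Ioi 0 →
        (∃ M : ℝ, ∀ ε ∈ S, ∀ x ∈ frontier Ω, φ ε x ≤ M) →
        LocallyEquiLipschitzOn Ω S u :=
  theorem2p3_general hn hΩ.isOpen hΩ.isBounded (P := Ioi 0)
    (fun _ hε => continuous_penalizedSource hδ hε hB)
    (fun _ hε => penalizedSource_nonneg hδ.le hε hB)
    (fun _ hε _ => penalizedSource_eq_zero_of_nonpos hδ.le hε hB) (fun ε hε => (hφW ε hε).1) hφ0
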